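/- Let $A\in\mathbb{R}^{n\times n}$ and consider the system $\dot x = Ax$, of which only the structure (the locations of the zero and non-zero entries of $A$) matters. Let $\mathcal{D}(A)$ be its state digraph, with vertex set $\mathcal{X}=\{x_1,\dots,x_n\}$ and an edge from $x_j$ to $x_i$ whenever $A_{ij}\neq 0$ (self-loops allowed), and let $\mathcal{E}$ be its edge set. A matrix $B\in\mathbb{R}^{n\times p}$ consists of $p$ *dedicated inputs* if each of its columns has exactly one non-zero entry. A pair $(A_0,B_0)$ is *structurally controllable* if for every $\varepsilon>0$ there are completely controllable pairs $(A_1,B_1)$ and $(A_2,B_2)$ with the same locations of zeros and non-zeros as $(A_0,B_0)$, such that $\|A_1-A_0\|>\varepsilon$ and $\|B_1-B_0\|>\varepsilon$ (each of these two inequalities being required only if the matrix $A_0$, respectively $B_0$, is non-zero), while $\|A_2-A_0\|<\varepsilon$ and $\|B_2-B_0\|<\varepsilon$. Here $(A,B)$ is completely controllable if every state can be steered to every other state in finite time along $\dot x=Ax+Bu$. A *matching* is a set of edges of $\mathcal{D}(A)$ no two of which have the same initial vertex or the same terminal vertex, i.e. a matching of the bipartite graph $\mathcal{B}(\mathcal{X},\mathcal{X},\mathcal{E})$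 whose two sides are copies of $\mathcal{X}$ and in which every edge $(x_j,x_i)\in\mathcal{E}$ joins the left copy of $x_j$ to the right copy of $x_i$. A *maximum matching* is a matching with the largest number of edges; a vertex is *right-unmatched* with respect to it if it is not the terminal vertex of any of its edges. A strongly connected component (SCC) of $\mathcal{D}(A)$ is *non-top linked* if no edge enters it from a vertex of another SCC. **Theorem.** Let $M^*$ be any maximum matching of $\mathcal{B}(\mathcal{X},\mathcal{X},\mathcal{E})$. Then the minimum number $p$ of dedicated inputs, i.e. the smallest $p\ge 0$ for which there is a $B\in\mathbb{R}^{n\times p}$ consisting of $p$ dedicated inputs such that $(A,B)$ is structurally controllable, exists and equals $$p=m+\beta-\alpha,$$ where $m$ is the number of right-unmatched vertices with respect to $M^*$, $\beta$ is the number of non-top linked SCCs of $\mathcal{D}(A)$, and $\alpha$ is the maximum assignability index, i.e. the maximum, over all maximum matchings $M$ of $\mathcal{B}(\mathcal{X},\mathcal{X},\mathcal{E})$, of the number of non-top linked SCCs that contain at least one vertex that is right-unmatched with respect to $M$. -/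

import Mathlib

namespace StructSys

/-! ### Linear time-invariant systems and structural controllability -/

/-- Complete controllability of `x' = A x + B u`: every state can be steered to every other state
in some finite time by a continuous control. -/
def Controllable {n p : ℕ} (A : Matrix (Fin n) (Fin n) ℝ) (B : Matrix (Fin n) (Fin p) ℝ) : Prop :=
  ∀ x₀ x₁ : Fin n → ℝ, ∃ T : ℝ, 0 < T ∧ ∃ (u : ℝ → Fin p → ℝ) (x : ℝ → Fin n → ℝ),
    ContinuousOn u (Set.Icc 0 T) ∧
    (∀ t ∈ Set.Icc 0 T,
      HasDerivWithinAt x (A.mulVec (x t) + B.mulVec (u t)) (Set.Icc 0 T) t) ∧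
    x 0 = x₀ ∧ x T = x₁

/-- Two real matrices have the same locations of zeros and non-zeros. -/
def SameStructure {m n : ℕ} (A A' : Matrix (Fin m) (Fin n) ℝ) : Prop :=
  ∀ i j, A i j = 0 ↔ A' i j = 0

section

open scoped Matrix.Norms.Elementwise

/-- Structural controllability: arbitrarily close to `(A₀, B₀)`, and also arbitrarily far from it,
there are completely controllable pairs with the same structure. (The zero matrix is the only matrix
of its structure, so the "far" requirement is imposed only on a non-zero matrix. The norm is the
largest absolute value of an entry; as `ε` is arbitrary, any other norm gives the same notion.) -/
def StructurallyControllable {n p : ℕ}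
    (A₀ : Matrix (Fin n) (Fin n) ℝ) (B₀ : Matrix (Fin n) (Fin p) ℝ) : Prop :=
  ∀ ε : ℝ, 0 < ε →
    (∃ (A₁ : Matrix (Fin n) (Fin n) ℝ) (B₁ : Matrix (Fin n) (Fin p) ℝ),
      SameStructure A₀ A₁ ∧ SameStructure B₀ B₁ ∧ Controllable A₁ B₁ ∧
      (A₀ ≠ 0 → ε < ‖A₁ - A₀‖) ∧ (B₀ ≠ 0 → ε < ‖B₁ - B₀‖)) ∧
    (∃ (A₂ : Matrix (Fin n) (Fin n) ℝ) (B₂ : Matrix (Fin n) (Fin p) ℝ),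
      SameStructure A₀ A₂ ∧ SameStructure B₀ B₂ ∧ Controllable A₂ B₂ ∧
      ‖A₂ - A₀‖ < ε ∧ ‖B₂ - B₀‖ < ε)

end

/-- All inputs are dedicated: each column of `B` has exactly one non-zero entry. -/
def IsDedicated {n p : ℕ} (B : Matrix (Fin n) (Fin p) ℝ) : Prop :=
  ∀ j, ∃! i, B i j ≠ 0

/-- The state digraph of `x' = A x`: an edge from `x_j` to `x_i` whenever `A i j ≠ 0`. -/
def stateDigraph {n : ℕ} (A : Matrix (Fin n) (Fin n) ℝ) : Digraph (Fin n) where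
  Adj j i := A i j ≠ 0

/-! ### Strongly connected components -/

/-- `S` is the vertex set of a strongly connected component of `D`: a maximal non-empty set of
vertices any two of which are joined by directed paths (possibly of length zero). -/
def IsSCC {V : Type*} (D : Digraph V) (S : Set V) : Prop :=
  Maximal (fun T : Set V => T.Nonempty ∧ ∀ v ∈ T, ∀ w ∈ T, Relation.ReflTransGen D.Adj v w) S

/-- A strongly connected component without incoming edges from vertices outside it. -/
def IsNonTopLinkedSCC {V : Type*} (D : Digraph V) (S : Set V) : Prop :=
  IsSCC D S ∧ ∀ v ∉ S, ∀ w ∈ S, ¬ D.Adj v w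

/-- The number of non-top linked strongly connected components. -/
noncomputable def numNonTopLinkedSCC {V : Type*} (D : Digraph V) : ℕ :=
  {S : Set V | IsNonTopLinkedSCC D S}.ncard

/-! ### Matchings of the state bipartite graph

The bipartite graph has two copies of `V` as its sides; an edge `(v, w)` of `D` joins `v` on the
left to `w` on the right. -/

/-- A set of edges no two of which share a left or a right endpoint. -/
def IsMatching {V : Type*} (D : Digraph V) (M : Finset (V × V)) : Prop :=
  (∀ e ∈ M, D.Adj e.1 e.2) ∧ ∀ e ∈ M, ∀ e' ∈ M, e ≠ e' → e.1 ≠ e'.1 ∧ e.2 ≠ e'.2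

/-- A matching with the largest number of edges among all matchings. -/
def IsMaximumMatching {V : Type*} (D : Digraph V) (M : Finset (V × V)) : Prop :=
  IsMatching D M ∧ ∀ M', IsMatching D M' → M'.card ≤ M.card

/-- The right vertices that belong to no edge of `M`. -/
def rightUnmatched {V : Type*} (M : Finset (V × V)) : Set V :=
  {w | ∀ v, (v, w) ∉ M}

/-- The number of top assignable components with respect to `M`: non-top linked strongly connected
components that contain a right-unmatched vertex. -/
noncomputable def numTopAssignable {V : Type*} (D : Digraph V) (M : Finset (V × V)) : ℕ :=
  {S : Set V | IsNonTopLinkedSCC D S ∧ (S ∩ rightUnmatched M).Nonempty}.ncard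

/-- The maximum assignability index: the largest number of top assignable components over all
maximum matchings. -/
noncomputable def maxAssignabilityIndex {V : Type*} (D : Digraph V) : ℕ :=
  sSup {k | ∃ M, IsMaximumMatching D M ∧ numTopAssignable D M = k}

/-- On a finite digraph the supremum in the maximum assignability index is attained. -/
theorem isGreatest_maxAssignabilityIndex {V : Type*} [Finite V] (D : Digraph V) :
    IsGreatest {k | ∃ M, IsMaximumMatching D M ∧ numTopAssignable D M = k}
      (maxAssignabilityIndex D) := by
  have hne : {k | ∃ M, IsMaximumMatching D M ∧ numTopAssignable D M = k}.Nonempty := by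
    have hfin : {M | IsMatching D M}.Finite := Set.toFinite _
    obtain ⟨M, hM, hmax⟩ := Set.exists_max_image _ Finset.card hfin
      ⟨∅, by simp [IsMatching]⟩
    exact ⟨_, M, ⟨hM, hmax⟩, rfl⟩
  have hbdd : BddAbove {k | ∃ M, IsMaximumMatching D M ∧ numTopAssignable D M = k} := by
    refine ⟨numNonTopLinkedSCC D, ?_⟩
    rintro k ⟨M, -, rfl⟩
    exact Set.ncard_le_ncard (fun S hS => hS.1) (Set.toFinite _)
  exact ⟨Nat.sSup_mem hne hbdd, fun k hk => le_csSup hbdd hk⟩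

end StructSys

/-! Complete controllability is equivalent to the Kalman condition (`Controllable.kalman`,
`Kalman.controllable`), which is the non-vanishing of the polynomial `(gramian A B).det`. One Kalman
pair supported in a structure therefore makes the structure controllable
(`StructurallyControllable.of_kalman`).

Let `S` be the set of input vertices. If a pair with the structure is controllable, then `S` meets
each non-top linked SCC, since otherwise a vector supported on it annihilates all `A ^ k * B`.
Moreover the rows of `[A B]` are independent, so Hall's theorem gives a matching whose
right-unmatched vertices lie in `S`, and by Mendelsohn–Dulmage a maximum one. Conversely, these two
properties suffice: the stems of the matching are controlled from their roots, and its cycles are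
added one at a time, with weights so large that their eigenvalues avoid the resonances of the part
already controlled (`HautusOn.exists_extension`).

It remains to minimise the size of such an `S`: it contains the right-unmatched vertices of a
maximum matching and one further vertex for each non-top linked SCC that they miss. The best
matching is the one attaining the maximum assignability index. -/

namespace StructSys

open Matrix

/-! ### Complete controllability and the Kalman condition. -/

/-- The Kalman condition for complete controllability: no non-zero row vector annihilates all the matrices `A ^ k * B`. -/
def Kalman {n p : ℕ} (A : Matrix (Fin n) (Fin n) ℝ) (B : Matrix (Fin n) (Fin p) ℝ) : Prop :=
  ∀ w : Fin n → ℝ, (∀ k : ℕ, w ᵥ* (A ^ k * B) = 0) → w = 0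

theorem hasDerivAt_exp_smul_apply {E : Type*} [NormedAddCommGroup E] [NormedSpace ℝ E]
    [CompleteSpace E] (H : E →L[ℝ] E) (z : E) (t : ℝ) :
    HasDerivAt (fun s : ℝ => NormedSpace.exp (s • H) z) (H (NormedSpace.exp (t • H) z)) t := by
  have h := (hasDerivAt_exp_smul_const' (𝕂 := ℝ) H t).clm_apply (hasDerivAt_const t z)
  simpa using h

theorem exp_smul_apply_eq_zero {E : Type*} [NormedAddCommGroup E] [NormedSpace ℝ E]
    [CompleteSpace E] (F : E →L[ℝ] E) (l : E →L[ℝ] ℝ) (y : E) (h : ∀ k : ℕ, l ((F ^ k) y) = 0)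
    (s : ℝ) : l (NormedSpace.exp (s • F) y) = 0 := by
  have h1 := NormedSpace.exp_series_hasSum_exp' (𝕂 := ℝ) (s • F)
  have h2 := h1.mapL (l.comp (ContinuousLinearMap.apply ℝ E y))
  refine h2.unique ?_
  convert hasSum_zero with k
  rw [smul_pow, map_smul, map_smul]
  change _ • _ • l ((F ^ k) y) = 0
  rw [h, smul_zero, smul_zero]

/-- If `w` annihilates all `A ^ k * B`, then `w ⬝ᵥ exp((T - t)A) x(t)` is constant along every
trajectory. Steering from `0` to `w` itself gives `w ⬝ᵥ w = 0`. -/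
theorem Controllable.kalman {n p : ℕ} {A : Matrix (Fin n) (Fin n) ℝ}
    {B : Matrix (Fin n) (Fin p) ℝ} (h : Controllable A B) : Kalman A B := by
  intro w hw
  obtain ⟨T, hT, u, x, -, hx, hx0, hxT⟩ := h 0 w
  set F : (Fin n → ℝ) →L[ℝ] (Fin n → ℝ) := LinearMap.toContinuousLinearMap A.mulVecLin with hF
  have hFa : ∀ y, F y = A *ᵥ y := fun y => rfl
  have hFp : ∀ (k : ℕ) y, (F ^ k) y = A ^ k *ᵥ y := by
    intro k
    induction k with
    | zero => intro y; simp
    | succ k ih => intro y; rw [pow_succ, pow_succ, mul_apply_eq_comp, ih, hFa,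
        mulVec_mulVec]
  set l : (Fin n → ℝ) →L[ℝ] ℝ :=
    LinearMap.toContinuousLinearMap (dotProductBilin ℝ ℝ w) with hl
  have hla : ∀ y, l y = w ⬝ᵥ y := fun y => rfl
  have hlB : ∀ (s : ℝ) v, l (NormedSpace.exp (s • F) (B *ᵥ v)) = 0 := by
    intro s v
    refine exp_smul_apply_eq_zero F l _ (fun k => ?_) s
    rw [hFp, hla, mulVec_mulVec, dotProduct_mulVec, hw, zero_dotProduct]
  have hder : ∀ t ∈ Set.Icc 0 T, HasDerivWithinAt
      (fun t => l (NormedSpace.exp ((T - t) • F) (x t))) 0 (Set.Icc 0 T) t := by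
    intro t ht
    have h1 : HasDerivAt (fun t : ℝ => NormedSpace.exp ((T - t) • F))
        (-(NormedSpace.exp ((T - t) • F) * F)) t := by
      have := (hasDerivAt_exp_smul_const (𝕂 := ℝ) F (T - t)).scomp t
        ((hasDerivAt_id t).const_sub T)
      simpa [Function.comp_def] using this
    have h2 := h1.hasDerivWithinAt.clm_apply (hx t ht)
    have h3 := l.hasFDerivAt.comp_hasDerivWithinAt t h2
    refine h3.congr_deriv ?_
    rw [map_add, map_add, map_add, hlB, _root_.neg_apply,
      mul_apply_eq_comp, hFa, map_neg]
    ring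
  have hconst := constant_of_derivWithin_zero (fun t ht => (hder t ht).differentiableWithinAt)
    (fun t ht => (hder t (Set.Ico_subset_Icc_self ht)).derivWithin
      (uniqueDiffOn_Icc hT t (Set.Ico_subset_Icc_self ht))) T (Set.right_mem_Icc.2 hT.le)
  simp only [sub_self, zero_smul, NormedSpace.exp_zero, hx0, hxT, map_zero,
    one_apply_eq_self, hla, dotProduct_zero] at hconst
  exact dotProduct_self_eq_zero.1 hconst

/-- The control comes from the Hamiltonian flow `x' = A x + B Bᵀ q`, `q' = -Aᵀ q`, with `u = Bᵀ q`.
The linear map from `q 0` to `x 1` with `x 0 = 0` is injective, hence surjective in finite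
dimension, and superposition handles any initial state. -/
theorem Kalman.controllable {n p : ℕ} {A : Matrix (Fin n) (Fin n) ℝ}
    {B : Matrix (Fin n) (Fin p) ℝ} (h : Kalman A B) : Controllable A B := by
  set E := Fin n → ℝ
  let f : E →L[ℝ] E := LinearMap.toContinuousLinearMap A.mulVecLin
  let g : E →L[ℝ] E := LinearMap.toContinuousLinearMap (B * Bᵀ).mulVecLin
  let f' : E →L[ℝ] E := LinearMap.toContinuousLinearMap A.vecMulLinear
  let H : (E × E) →L[ℝ] (E × E) :=
    (f.comp (.fst ℝ E E) + g.comp (.snd ℝ E E)).prod (-(f'.comp (.snd ℝ E E)))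
  have hz : ∀ z t, HasDerivAt (fun s : ℝ => NormedSpace.exp (s • H) z)
      (H (NormedSpace.exp (t • H) z)) t := hasDerivAt_exp_smul_apply H
  have hx : ∀ z t, HasDerivAt (fun s : ℝ => (NormedSpace.exp (s • H) z).1)
      (A *ᵥ (NormedSpace.exp (t • H) z).1 + B *ᵥ ((NormedSpace.exp (t • H) z).2 ᵥ* B)) t := by
    intro z t
    have := (ContinuousLinearMap.fst ℝ E E).hasFDerivAt.comp_hasDerivAt t (hz z t)
    refine this.congr_deriv ?_
    change A *ᵥ _ + (B * Bᵀ) *ᵥ _ = _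
    rw [← mulVec_mulVec, mulVec_transpose]
    rfl
  have hp : ∀ z t, HasDerivAt (fun s : ℝ => (NormedSpace.exp (s • H) z).2)
      (-((NormedSpace.exp (t • H) z).2 ᵥ* A)) t := fun z t =>
    (ContinuousLinearMap.snd ℝ E E).hasFDerivAt.comp_hasDerivAt t (hz z t)
  have hinit : ∀ z, NormedSpace.exp ((0 : ℝ) • H) z = z := by
    intro z; simp
  have hinj : ∀ p₀ : E, (NormedSpace.exp ((1 : ℝ) • H) (0, p₀)).1 = 0 → p₀ = 0 := by
    intro p₀ h1
    set x : ℝ → E := fun s => (NormedSpace.exp (s • H) (0, p₀)).1 with hxdef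
    set q : ℝ → E := fun s => (NormedSpace.exp (s • H) (0, p₀)).2 with hqdef
    have hx' : ∀ t, HasDerivAt x (A *ᵥ x t + B *ᵥ (q t ᵥ* B)) t := hx (0, p₀)
    have hq' : ∀ t, HasDerivAt q (-(q t ᵥ* A)) t := hp (0, p₀)
    have hx0 : x 0 = 0 := by rw [hxdef]; simp
    have hq0 : q 0 = p₀ := by rw [hqdef]; simp
    -- The pairing `q ⬝ᵥ x` has derivative `|q B|² ≥ 0` and vanishes at both ends of `[0, 1]`, so it
    -- is zero in between and `q B = 0` there. Repeated differentiation gives `q A ^ k B = 0`.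
    have hφ : ∀ t, HasDerivAt (fun s => q s ⬝ᵥ x s) ((q t ᵥ* B) ⬝ᵥ (q t ᵥ* B)) t := by
      intro t
      have h2 : HasDerivAt (fun s => ∑ i, q s i * x s i)
          (∑ i, ((-(q t ᵥ* A)) i * x t i + q t i * (A *ᵥ x t + B *ᵥ (q t ᵥ* B)) i)) t :=
        HasDerivAt.fun_sum fun i _ =>
          (hasDerivAt_pi.1 (hq' t) i).mul (hasDerivAt_pi.1 (hx' t) i)
      refine h2.congr_deriv ?_
      rw [Finset.sum_add_distrib]
      change (-(q t ᵥ* A)) ⬝ᵥ x t + q t ⬝ᵥ (A *ᵥ x t + B *ᵥ (q t ᵥ* B)) = _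
      rw [neg_dotProduct, dotProduct_add, ← dotProduct_mulVec, dotProduct_mulVec (q t) B]
      ring
    have hmono : Monotone fun s => q s ⬝ᵥ x s :=
      monotone_of_hasDerivAt_nonneg hφ fun t => by
        simpa using dotProduct_star_self_nonneg (q t ᵥ* B)
    have hzero : ∀ t ∈ Set.Ioo (0 : ℝ) 1, q t ⬝ᵥ x t = 0 := by
      intro t ht
      refine le_antisymm ?_ ?_
      · have := hmono ht.2.le
        simpa [show x 1 = 0 from h1] using this
      · have := hmono ht.1.le
        simpa [hx0] using this
    have hk : ∀ k : ℕ, ∀ t ∈ Set.Ioo (0 : ℝ) 1, q t ᵥ* (A ^ k * B) = 0 := by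
      intro k
      induction k with
      | zero =>
        intro t ht
        have h2 : HasDerivAt (fun s => q s ⬝ᵥ x s) 0 t :=
          (hasDerivAt_const t (0 : ℝ)).congr_of_eventuallyEq
            (Filter.eventuallyEq_of_mem (isOpen_Ioo.mem_nhds ht) hzero)
        have h3 := (hφ t).unique h2
        simpa using h3
      | succ k ih =>
        intro t ht
        have h2 : HasDerivAt (fun s => q s ᵥ* (A ^ k * B)) 0 t :=
          (hasDerivAt_const t (0 : Fin p → ℝ)).congr_of_eventuallyEq
            (Filter.eventuallyEq_of_mem (isOpen_Ioo.mem_nhds ht) ih)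
        have h3 : HasDerivAt (fun s => q s ᵥ* (A ^ k * B)) (-(q t ᵥ* A) ᵥ* (A ^ k * B)) t :=
          (LinearMap.toContinuousLinearMap
            (A ^ k * B).vecMulLinear).hasFDerivAt.comp_hasDerivAt t (hq' t)
        have h4 := h3.unique h2
        rw [neg_vecMul, neg_eq_zero, vecMul_vecMul, ← Matrix.mul_assoc, ← pow_succ'] at h4
        exact h4
    refine h p₀ fun k => ?_
    have hcont : Continuous fun s => q s ᵥ* (A ^ k * B) :=
      (LinearMap.toContinuousLinearMap (A ^ k * B).vecMulLinear).continuous.comp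
        (continuous_iff_continuousAt.2 fun t => (hq' t).continuousAt)
    have hcl : Set.EqOn (fun s => q s ᵥ* (A ^ k * B)) (fun _ => 0) (closure (Set.Ioo 0 1)) :=
      Set.EqOn.closure (hk k) hcont continuous_const
    have := hcl (show (0 : ℝ) ∈ closure (Set.Ioo 0 1) by
      rw [closure_Ioo zero_ne_one]; exact Set.left_mem_Icc.2 zero_le_one)
    simpa [hq0] using this
  let L : E →ₗ[ℝ] E := (LinearMap.fst ℝ E E).comp
    ((NormedSpace.exp ((1 : ℝ) • H)).toLinearMap.comp (LinearMap.inr ℝ E E))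
  have hLinj : Function.Injective L := by
    rw [injective_iff_map_eq_zero]
    exact hinj
  have hLsurj := LinearMap.injective_iff_surjective.1 hLinj
  intro x₀ x₁
  obtain ⟨p₀, hp₀⟩ := hLsurj (x₁ - (NormedSpace.exp ((1 : ℝ) • H) (x₀, 0)).1)
  refine ⟨1, one_pos, fun s => (NormedSpace.exp (s • H) (x₀, p₀)).2 ᵥ* B,
    fun s => (NormedSpace.exp (s • H) (x₀, p₀)).1, ?_, fun t _ => (hx _ t).hasDerivWithinAt,
    by simp, ?_⟩
  · exact ((LinearMap.toContinuousLinearMap B.vecMulLinear).continuous.comp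
      (continuous_iff_continuousAt.2 fun t => (hp _ t).continuousAt)).continuousOn
  · have h1 : (x₀, p₀) = (x₀, (0 : E)) + ((0 : E), p₀) := by simp
    have h2 : (NormedSpace.exp ((1 : ℝ) • H) (0, p₀)).1 = _ := hp₀
    change (NormedSpace.exp ((1 : ℝ) • H) (x₀, p₀)).1 = x₁
    rw [h1, map_add, Prod.fst_add, h2]
    simp

end StructSys

/-! ### The Gramian determinant and genericity of the Kalman condition. -/

namespace StructSys

open Matrix Polynomial

/-- A finite controllability Gramian over any commutative ring. -/
def gramian {R : Type*} [CommRing R] {n p : ℕ} (A : Matrix (Fin n) (Fin n) R)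
    (B : Matrix (Fin n) (Fin p) R) : Matrix (Fin n) (Fin n) R :=
  ∑ k ∈ Finset.range n, (A ^ k * B) * (A ^ k * B)ᵀ

theorem gramian_map {R S : Type*} [CommRing R] [CommRing S] (f : R →+* S) {n p : ℕ}
    (A : Matrix (Fin n) (Fin n) R) (B : Matrix (Fin n) (Fin p) R) :
    (gramian A B).map f = gramian (A.map f) (B.map f) := by
  have hpow : ∀ k : ℕ, (A ^ k).map f = A.map f ^ k := fun k => by
    simpa using map_pow f.mapMatrix A k
  have hs := map_sum f.mapMatrix (fun k => (A ^ k * B) * (A ^ k * B)ᵀ) (Finset.range n)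
  simp only [RingHom.mapMatrix_apply] at hs
  rw [gramian, hs, gramian]
  refine Finset.sum_congr rfl fun k _ => ?_
  rw [Matrix.map_mul, Matrix.transpose_map, Matrix.map_mul, hpow]

theorem kalman_of_det_gramian_ne_zero {n p : ℕ} {A : Matrix (Fin n) (Fin n) ℝ}
    {B : Matrix (Fin n) (Fin p) ℝ} (h : (gramian A B).det ≠ 0) : Kalman A B := by
  intro w hw
  refine eq_zero_of_vecMul_eq_zero h ?_
  rw [gramian, vecMul_sum]
  exact Finset.sum_eq_zero fun k _ => by rw [← vecMul_vecMul, hw, zero_vecMul]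

/-- By Cayley–Hamilton every power of `A` is a combination of the first `n`. -/
theorem vecMul_pow_mul_eq_zero {n p : ℕ} {A : Matrix (Fin n) (Fin n) ℝ}
    {B : Matrix (Fin n) (Fin p) ℝ} {w : Fin n → ℝ}
    (h : ∀ k < n, w ᵥ* (A ^ k * B) = 0) (k : ℕ) : w ᵥ* (A ^ k * B) = 0 := by
  rcases Nat.eq_zero_or_pos n with rfl | hn
  · ext j
    simp [vecMul, dotProduct]
  · have : Nonempty (Fin n) := ⟨⟨0, hn⟩⟩
    rw [Matrix.pow_eq_aeval_mod_charpoly]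
    have hdeg : (X ^ k %ₘ A.charpoly).natDegree < n := by
      have h1 := natDegree_modByMonic_lt (X ^ k) A.charpoly_monic (by
        intro h1
        have := A.charpoly_natDegree_eq_dim
        rw [h1] at this
        simp at this
        omega)
      simpa [A.charpoly_natDegree_eq_dim] using h1
    rw [aeval_eq_sum_range' hdeg, Matrix.sum_mul, vecMul_sum]
    refine Finset.sum_eq_zero fun i hi => ?_
    rw [Matrix.smul_mul, vecMul_smul, h i (Finset.mem_range.1 hi), smul_zero]

/-- Over the reals `w G wᵀ` is the sum of the squares `|w A ^ k B|²`, so a null vector of the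
Gramian annihilates every term. -/
theorem Kalman.det_gramian_ne_zero {n p : ℕ} {A : Matrix (Fin n) (Fin n) ℝ}
    {B : Matrix (Fin n) (Fin p) ℝ} (h : Kalman A B) : (gramian A B).det ≠ 0 := by
  intro hdet
  obtain ⟨w, hw0, hw⟩ := exists_vecMul_eq_zero_iff.2 hdet
  refine hw0 (h w (vecMul_pow_mul_eq_zero fun k hk => ?_))
  have h1 : ∑ k ∈ Finset.range n, (w ᵥ* (A ^ k * B)) ⬝ᵥ (w ᵥ* (A ^ k * B)) = 0 := by
    have h2 : w ᵥ* gramian A B ⬝ᵥ w = 0 := by rw [hw, zero_dotProduct]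
    rw [gramian, vecMul_sum, sum_dotProduct] at h2
    rw [← h2]
    refine Finset.sum_congr rfl fun k _ => ?_
    rw [← vecMul_vecMul w (A ^ k * B), vecMul_transpose,
      dotProduct_comm (_ *ᵥ _), dotProduct_mulVec]
  have h3 := (Finset.sum_eq_zero_iff_of_nonneg fun k _ => by
    simpa using dotProduct_star_self_nonneg (w ᵥ* (A ^ k * B))).1 h1 k (Finset.mem_range.2 hk)
  exact dotProduct_self_eq_zero.1 h3

/-- If some pair whose state matrix is supported in the structure of `A` satisfies the Kalman
condition, then so do state matrices arbitrarily close to `A`. -/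
theorem Kalman.eventually_add_smul {n p : ℕ} {A A' : Matrix (Fin n) (Fin n) ℝ}
    {B : Matrix (Fin n) (Fin p) ℝ} (h : Kalman A' B) :
    ∀ᶠ t in nhdsWithin (0 : ℝ) {0}ᶜ, Kalman (A + t • (A' - A)) B := by
  set c : ℝ →+* ℝ[X] := Polynomial.C
  set P : ℝ[X] := (gramian (A.map c + (X : ℝ[X]) • (A' - A).map c) (B.map c)).det with hP
  have heval : ∀ t, P.eval t = (gramian (A + t • (A' - A)) B).det := by
    intro t
    have h1 := RingHom.map_det (evalRingHom t)
      (gramian (A.map c + (X : ℝ[X]) • (A' - A).map c) (B.map c))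
    rw [RingHom.mapMatrix_apply, gramian_map] at h1
    rw [hP]
    refine h1.trans ?_
    congr 2
    · ext i j; simp [c]
    · ext i j; simp [c]
  -- At `t = 1` the matrix is `A'`, where the determinant is non-zero; hence the polynomial has
  -- finitely many roots.
  have hP0 : P ≠ 0 := by
    intro h0
    have := heval 1
    rw [h0, one_smul, add_sub_cancel, eval_zero] at this
    exact h.det_gramian_ne_zero this.symm
  have hfin : {t | P.IsRoot t}.Finite := Polynomial.finite_setOfPred_isRoot hP0
  have : ∀ᶠ t in nhdsWithin (0 : ℝ) {0}ᶜ, ¬ P.IsRoot t := by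
    have h1 : (({t | P.IsRoot t} \ {0})ᶜ : Set ℝ) ∈ nhds (0 : ℝ) :=
      (hfin.subset Set.sdiff_subset).isClosed.isOpen_compl.mem_nhds (by simp)
    filter_upwards [mem_nhdsWithin_of_mem_nhds h1, self_mem_nhdsWithin] with t ht ht0 hr
    exact ht ⟨hr, ht0⟩
  filter_upwards [this] with t ht
  exact kalman_of_det_gramian_ne_zero (by rwa [← heval])

theorem Kalman.smul {n p : ℕ} {A : Matrix (Fin n) (Fin n) ℝ} {B : Matrix (Fin n) (Fin p) ℝ}
    (h : Kalman A B) {c : ℝ} (hc : c ≠ 0) : Kalman (c • A) (c • B) := by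
  intro w hw
  refine h w fun k => ?_
  have h1 := hw k
  rw [_root_.smul_pow, Matrix.smul_mul, Matrix.mul_smul, vecMul_smul, vecMul_smul, smul_smul] at h1
  exact (smul_eq_zero.1 h1).resolve_left (mul_ne_zero (pow_ne_zero _ hc) hc)

open scoped Matrix.Norms.Elementwise in
-- A small move from `A` towards `A'` keeps the zeros, and by continuity the non-zeros, while `B`
-- stays fixed: this gives the near pair. Scaling both matrices of that pair by a large constant
-- gives the far one.
theorem StructurallyControllable.of_kalman {n p : ℕ} {A A' : Matrix (Fin n) (Fin n) ℝ}
    {B : Matrix (Fin n) (Fin p) ℝ} (hA' : ∀ i j, A i j = 0 → A' i j = 0) (h : Kalman A' B) :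
    StructurallyControllable A B := by
  have hcont : Continuous fun t : ℝ => A + t • (A' - A) := by fun_prop
  have hnear : ∀ ε : ℝ, 0 < ε → ∃ A₂, SameStructure A A₂ ∧ Kalman A₂ B ∧ ‖A₂ - A‖ < ε := by
    intro ε hε
    have h1 : ∀ᶠ t in nhds (0 : ℝ), ‖(A + t • (A' - A)) - A‖ < ε := by
      have h2 : Continuous fun t : ℝ => ‖(A + t • (A' - A)) - A‖ := by fun_prop
      exact h2.continuousAt.eventually_lt continuousAt_const (by simpa using hε)
    have h2 : ∀ᶠ t in nhds (0 : ℝ), ∀ i j, A i j ≠ 0 → (A + t • (A' - A)) i j ≠ 0 := by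
      rw [Filter.eventually_all]
      intro i
      rw [Filter.eventually_all]
      intro j
      by_cases hij : A i j = 0
      · simp [hij]
      · have h3 : ContinuousAt (fun t : ℝ => (A + t • (A' - A)) i j) 0 := by
          simp only [Matrix.add_apply, Matrix.smul_apply, Matrix.sub_apply]
          fun_prop
        exact (h3.eventually_ne (by simpa using hij)).mono fun t ht _ => ht
    obtain ⟨t, ⟨ht1, ht2⟩, ht3⟩ := ((h1.and h2).filter_mono nhdsWithin_le_nhds).and
      (h.eventually_add_smul (A := A)) |>.exists
    refine ⟨_, fun i j => ⟨fun h0 => ?_, fun h0 => ?_⟩, ht3, ht1⟩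
    · simp [h0, hA' i j h0]
    · by_contra hne
      exact ht2 i j hne h0
  intro ε hε
  obtain ⟨A₂, hs, hk, hn⟩ := hnear ε hε
  refine ⟨?_, A₂, B, hs, fun _ _ => Iff.rfl, hk.controllable, hn, by simpa using hε⟩
  have hfar : ∀ {q : ℕ} (M N : Matrix (Fin n) (Fin q) ℝ), (N ≠ 0 → M ≠ 0) →
      ∀ᶠ c : ℝ in Filter.atTop, N ≠ 0 → ε < ‖c • M - N‖ := by
    intro q M N hMN
    by_cases hN : N = 0
    · simp [hN]
    · have hM : 0 < ‖M‖ := norm_pos_iff.2 (hMN hN)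
      filter_upwards [Filter.eventually_gt_atTop ((ε + ‖N‖) / ‖M‖),
        Filter.eventually_ge_atTop 0] with c hc hc0 _
      rw [div_lt_iff₀ hM] at hc
      have := norm_sub_norm_le (c • M) N
      rw [norm_smul, Real.norm_of_nonneg hc0] at this
      linarith
  have hne : A ≠ 0 → A₂ ≠ 0 := by
    rintro h1 rfl
    exact h1 (by ext i j; exact (hs i j).2 rfl)
  obtain ⟨c, ⟨h1, h2⟩, h3⟩ := ((hfar A₂ A hne).and (hfar B B id)).and
    (Filter.eventually_gt_atTop (0 : ℝ)) |>.exists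
  refine ⟨c • A₂, c • B, fun i j => ?_, fun i j => ?_, (hk.smul h3.ne').controllable, h1, h2⟩
  · simp [hs i j, h3.ne']
  · simp [h3.ne']

end StructSys

namespace StructSys

/-! ### Generic controllability of a structure spanned by a matching -/

section LinearAlgebra

variable {E : Type*} [NormedAddCommGroup E] [NormedSpace ℂ E] [FiniteDimensional ℂ E]

theorem eq_bot_of_forall_eigenvector_eq_zero (T : E →ₗ[ℂ] E) (N : Submodule ℂ E)
    (hN : ∀ x ∈ N, T x ∈ N) (h : ∀ (μ : ℂ), ∀ w ∈ N, T w = μ • w → w = 0) : N = ⊥ := by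
  by_contra hne
  have : Nontrivial N := Submodule.nontrivial_iff_ne_bot.2 hne
  obtain ⟨μ, hμ⟩ := Module.End.exists_eigenvalue (T.restrict hN)
  obtain ⟨w, hw⟩ := hμ.exists_hasEigenvector
  refine hw.2 (Subtype.ext (h μ w w.2 ?_))
  exact congrArg Subtype.val hw.apply_eq_smul

/-- If `U` contains no eigenvector of `T`, the resonances of a non-zero vector `e` in `U` are
bounded. -/
theorem exists_bound_resonance (T : E →ₗ[ℂ] E) (U : Submodule ℂ E)
    (hU : ∀ (μ : ℂ), ∀ w ∈ U, T w = μ • w → w = 0) {e : E} (he : e ≠ 0) :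
    ∃ R : ℝ, ∀ (μ : ℂ), ∀ w ∈ U, T w = μ • w + e → ‖μ‖ ≤ R := by
  by_contra! hR
  -- If `T w = μ • w + e` with `‖μ‖` large, then `w` is small and `-(μ • w) = e - T w` is close to
  -- `e`. So `e` lies in the closed span `N` of these `w`; then `N` is `T`-invariant, non-zero and
  -- inside `U`, and contains an eigenvector.
  set N : Submodule ℂ E := Submodule.span ℂ {w | w ∈ U ∧ ∃ μ : ℂ, T w = μ • w + e} with hNdef
  have hNU : N ≤ U := Submodule.span_le.2 fun w hw => hw.1
  set T' : E →L[ℂ] E := LinearMap.toContinuousLinearMap T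
  have heN : e ∈ N := by
    have hcl : IsClosed (N : Set E) := N.closed_of_finiteDimensional
    rw [← SetLike.mem_coe, ← hcl.closure_eq, Metric.mem_closure_iff]
    intro ε hε
    -- Beyond this bound `K * ‖w‖ ≤ ‖e‖` with `K * ε = ‖T'‖ * ‖e‖ + 1`, which forces `‖T w‖ < ε`.
    obtain ⟨μ, w, hwU, hw, hμ⟩ := hR (‖T'‖ + (‖T'‖ * ‖e‖ + 1) / ε)
    refine ⟨-(μ • w), N.neg_mem (N.smul_mem _ (Submodule.subset_span ⟨hwU, μ, hw⟩)), ?_⟩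
    have h1 : ‖T w‖ ≤ ‖T'‖ * ‖w‖ := T'.le_opNorm w
    rw [dist_eq_norm, sub_neg_eq_add, add_comm, ← hw]
    have h2 : ‖μ‖ * ‖w‖ ≤ ‖T'‖ * ‖w‖ + ‖e‖ := by
      rw [← norm_smul, show μ • w = T w - e by rw [hw]; abel]
      exact (norm_sub_le _ _).trans (by linarith)
    have hT : 0 ≤ ‖T'‖ := norm_nonneg _
    have he0 : 0 ≤ ‖e‖ := norm_nonneg _
    have hw0 : 0 ≤ ‖w‖ := norm_nonneg _
    set K := (‖T'‖ * ‖e‖ + 1) / ε with hK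
    have hKpos : 0 < K := by positivity
    have hKε : K * ε = ‖T'‖ * ‖e‖ + 1 := by rw [hK]; field_simp
    have h3 : K * ‖w‖ ≤ ‖e‖ := by nlinarith
    have h4 : K * ‖T w‖ < K * ε := by
      rw [hKε]
      nlinarith [mul_le_mul_of_nonneg_left h1 hKpos.le, mul_le_mul_of_nonneg_left h3 hT]
    exact lt_of_mul_lt_mul_left h4 hKpos.le
  have hTN : ∀ x ∈ N, T x ∈ N := by
    have : N ≤ N.comap T := by
      rw [hNdef, Submodule.span_le, ← hNdef]
      rintro w ⟨hw, μ, hμ⟩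
      change T w ∈ N
      rw [hμ]
      exact N.add_mem (N.smul_mem _ (Submodule.subset_span ⟨hw, μ, hμ⟩)) heN
    exact this
  have hbot := eq_bot_of_forall_eigenvector_eq_zero T N hTN
    fun μ w hw => hU μ w (hNU hw)
  rw [hbot, Submodule.mem_bot] at heN
  exact he heN

end LinearAlgebra

theorem IsMatching.left_unique {V : Type*} {D : Digraph V} {M : Finset (V × V)}
    (hM : IsMatching D M) {x y y' : V} (h : (x, y) ∈ M)
    (h' : (x, y') ∈ M) : y = y' := by
  by_contra hne
  exact (hM.2 _ h _ h' (by simpa using hne)).1 rfl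

variable {V : Type*} [Fintype V] {D : Digraph V} {M : Finset (V × V)} {S I : Set V}
  {a : V → V → ℝ}

/-- The Hautus condition for the subsystem on `I` with dedicated inputs at the vertices of `S`. -/
def HautusOn (a : V → V → ℝ) (I S : Set V) : Prop :=
  ∀ (μ : ℂ) (w : V → ℂ), (∀ j ∈ I, ∑ i, w i * (a i j : ℂ) = μ * w j) →
    (∀ s ∈ I, s ∈ S → w s = 0) → ∀ i ∈ I, w i = 0

/-- The weights `a` vanish off the edges of `D` inside `I`. -/
def SupportedOn (D : Digraph V) (a : V → V → ℝ) (I : Set V) : Prop :=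
  ∀ i j, a i j ≠ 0 → D.Adj j i ∧ i ∈ I ∧ j ∈ I

/-- `I` contains the end vertex of each edge of `M` whose initial vertex it contains. -/
def ForwardClosed (M : Finset (V × V)) (I : Set V) : Prop :=
  ∀ x y, (x, y) ∈ M → x ∈ I → y ∈ I

/-- The union of the stems of a matching: the paths of `M` that start at right-unmatched
vertices. -/
theorem exists_hautusOn_stems (hM : IsMatching D M) (hS : rightUnmatched M ⊆ S) :
    ∃ (I : Set V) (a : V → V → ℝ), rightUnmatched M ⊆ I ∧ ForwardClosed M I ∧
      SupportedOn D a I ∧ HautusOn a I S := by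
  classical
  set r : V → V → Prop := fun x y => (x, y) ∈ M with hr
  set I : Set V := {y | ∃ u ∈ rightUnmatched M, Relation.ReflTransGen r u y} with hI
  have hcl : ForwardClosed M I := fun x y hxy ⟨u, hu, hux⟩ => ⟨u, hu, hux.tail hxy⟩
  have hU : rightUnmatched M ⊆ I := fun u hu => ⟨u, hu, .refl⟩
  refine ⟨I, fun i j => if (j, i) ∈ M ∧ j ∈ I then 1 else 0, hU, hcl, ?_, ?_⟩
  · intro i j hij
    have h : (j, i) ∈ M ∧ j ∈ I := by
      by_contra h
      exact hij (if_neg h)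
    exact ⟨hM.1 _ h.1, hcl _ _ h.1 h.2, h.2⟩
  -- The column equation at `j` has the single term `w i` for the successor `i` of `j`, so vanishing
  -- spreads from the root along each stem.
  · rintro μ w hw hws i ⟨u, hu, hui⟩
    induction hui with
    | refl => exact hws u (hU hu) (hS hu)
    | @tail j i hj hji ih =>
      have hjI : j ∈ I := ⟨u, hu, hj⟩
      have h1 := hw j hjI
      rw [ih, mul_zero, Finset.sum_eq_single i] at h1
      · have h2 : (j, i) ∈ M := hji
        simpa [h2, hjI] using h1
      · intro b _ hb
        have h2 : ¬((j, b) ∈ M ∧ j ∈ I) := fun h => hb (hM.left_unique h.1 hji)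
        simp [h2]
      · simp

/-- The edges of `M` outside `I` form disjoint cycles. -/
theorem exists_perm_matching (hM : IsMatching D M) (hU : rightUnmatched M ⊆ I)
    (hI : ForwardClosed M I) :
    ∃ σ : Equiv.Perm V, (∀ x ∉ I, (x, σ x) ∈ M) ∧ ∀ x, σ x ∈ I ↔ x ∈ I := by
  classical
  -- The map `f` sends a vertex outside `I` to its predecessor in `M` and fixes `I`; it is injective
  -- on a finite set, and `σ` is its inverse.
  have hex : ∀ y, ∃ x, (y ∈ I → x = y) ∧ (y ∉ I → (x, y) ∈ M) := by
    intro y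
    by_cases hy : y ∈ I
    · exact ⟨y, fun _ => rfl, fun h => absurd hy h⟩
    · have : y ∉ rightUnmatched M := fun h => hy (hU h)
      simp only [rightUnmatched, Set.mem_ofPred_eq, not_forall, not_not] at this
      obtain ⟨x, hx⟩ := this
      exact ⟨x, fun h => absurd h hy, fun _ => hx⟩
  choose f hf1 hf2 using hex
  have hfI : ∀ y, f y ∈ I ↔ y ∈ I := by
    intro y
    constructor
    · intro h
      by_contra hy
      exact hy (hI _ _ (hf2 y hy) h)
    · intro h
      rw [hf1 y h]
      exact h
  have hinj : Function.Injective f := by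
    intro y z hyz
    by_cases hy : y ∈ I
    · have hz : z ∈ I := by rw [← hfI z, ← hyz, hfI]; exact hy
      rw [← hf1 y hy, hyz, hf1 z hz]
    · have hz : z ∉ I := by rw [← hfI z, ← hyz, hfI]; exact hy
      have h1 := hf2 y hy
      rw [hyz] at h1
      exact hM.left_unique h1 (hf2 z hz)
  let σ := (Equiv.ofBijective f (Finite.injective_iff_bijective.1 hinj))
  have hσ : ∀ x, f (σ.symm x) = x := fun x => σ.apply_symm_apply x
  refine ⟨σ.symm, fun x hx => ?_, fun x => ?_⟩
  · have hx' : σ.symm x ∉ I := by rw [← hfI, hσ]; exact hx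
    have := hf2 _ hx'
    rwa [hσ] at this
  · rw [← hfI, hσ]

/-- Dividing `w` by `-z` and cutting it off outside `I` turns the equation into `T w = μ • w + e`
with `e` the unit vector at `v`, so that `exists_bound_resonance` applies. -/
theorem HautusOn.exists_bound (h : HautusOn a I S) (hsupp : SupportedOn D a I) {v : V}
    (hv : v ∈ I) [DecidableEq V] : ∃ R : ℝ, ∀ (μ : ℂ) (w : V → ℂ) (z : ℂ), z ≠ 0 →
      (∀ j ∈ I, ∑ i, w i * (a i j : ℂ) + z * (Pi.single v 1 : V → ℂ) j = μ * w j) →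
      (∀ s ∈ I, s ∈ S → w s = 0) → ‖μ‖ ≤ R := by
  classical
  let A : Matrix V V ℂ := fun i j => (a i j : ℂ)
  have ha : ∀ i j, i ∉ I ∨ j ∉ I → a i j = 0 := by
    intro i j hij
    by_contra hne
    have := hsupp i j hne
    tauto
  let U : Submodule ℂ (V → ℂ) :=
    { carrier := {w | (∀ i ∉ I, w i = 0) ∧ ∀ s ∈ I, s ∈ S → w s = 0}
      add_mem' := by
        rintro x y ⟨h1, h2⟩ ⟨h3, h4⟩
        exact ⟨fun i hi => by simp [h1 i hi, h3 i hi],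
          fun i hi hs => by simp [h2 i hi hs, h4 i hi hs]⟩
      zero_mem' := by simp
      smul_mem' := by
        rintro c x ⟨h1, h2⟩
        exact ⟨fun i hi => by simp [h1 i hi], fun i hi hs => by simp [h2 i hi hs]⟩ }
  have hT : ∀ w j, A.vecMulLinear w j = ∑ i, w i * (a i j : ℂ) := fun w j => rfl
  obtain ⟨R, hR⟩ := exists_bound_resonance A.vecMulLinear U (by
    rintro μ w ⟨hw1, hw2⟩ hw
    ext i
    by_cases hi : i ∈ I
    · refine h μ w (fun j _ => ?_) hw2 i hi
      rw [← hT, hw]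
      rfl
    · exact hw1 i hi) (e := Pi.single v 1) (by
    intro h0
    have := congrFun h0 v
    simp at this)
  refine ⟨R, fun μ w z hz hw hws => hR μ (fun i => if i ∈ I then -(w i / z) else 0)
    ⟨fun i hi => if_neg hi, fun s hs hsS => by simp [hws s hs hsS]⟩ ?_⟩
  ext j
  rw [hT]
  by_cases hj : j ∈ I
  · have h1 := hw j hj
    have h2 : ∑ i, (if i ∈ I then -(w i / z) else 0) * (a i j : ℂ)
        = -(∑ i, w i * (a i j : ℂ)) / z := by
      rw [neg_div, Finset.sum_div, ← Finset.sum_neg_distrib]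
      refine Finset.sum_congr rfl fun i _ => ?_
      by_cases hi : i ∈ I
      · rw [if_pos hi]; ring
      · rw [ha i j (Or.inl hi)]; simp
    rw [h2, eq_sub_of_add_eq h1]
    simp only [Pi.add_apply, Pi.smul_apply, smul_eq_mul, if_pos hj]
    field_simp
    ring
  · have hjv : j ≠ v := fun h => hj (h ▸ hv)
    simp [ha _ j (Or.inr hj), hj, hjv]

/-- A cycle of the matching that is entered from the controlled part, or that carries an input,
can be added to the controlled part. -/
theorem HautusOn.exists_extension (hM : IsMatching D M) (hU : rightUnmatched M ⊆ I)
    (hI : ForwardClosed M I) (hsupp : SupportedOn D a I) (h : HautusOn a I S) {c : V}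
    (hc : c ∉ I) (hlink : c ∈ S ∨ ∃ v ∈ I, D.Adj v c) :
    ∃ (I' : Set V) (a' : V → V → ℝ), I ⊂ I' ∧ ForwardClosed M I' ∧ SupportedOn D a' I' ∧
      HautusOn a' I' S := by
  classical
  -- `κ` holds the weights of the edges from `I` to `c`: one unit edge, or none if `c` carries an
  -- input. `R` bounds the `μ` compatible with `w c ≠ 0`.
  obtain ⟨κ, R, hκ, hR⟩ : ∃ (κ : V → ℝ) (R : ℝ), (∀ j, κ j ≠ 0 → j ∈ I ∧ D.Adj j c) ∧
      ∀ (μ : ℂ) (w : V → ℂ), (∀ j ∈ I, ∑ i, w i * (a i j : ℂ) + w c * κ j = μ * w j) →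
        (∀ s ∈ I, s ∈ S → w s = 0) → (c ∈ S → w c = 0) → w c ≠ 0 → ‖μ‖ ≤ R := by
    rcases hlink with hcS | ⟨v, hv, hvc⟩
    · exact ⟨0, 0, by simp, fun μ w _ _ h1 h2 => absurd (h1 hcS) h2⟩
    · obtain ⟨R, hR⟩ := h.exists_bound hsupp hv
      refine ⟨Pi.single v 1, R, fun j hj => ?_, fun μ w h1 h2 _ h3 =>
        hR μ w (w c) h3 (fun j hj => ?_) h2⟩
      · have : j = v := by
          by_contra hne
          simp [hne] at hj
        exact this ▸ ⟨hv, hvc⟩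
      · rw [← h1 j hj]
        congr 2
        by_cases hjv : j = v
        · subst hjv; simp
        · simp [hjv]
  obtain ⟨σ, hσM, hσI⟩ := exists_perm_matching hM hU hI
  set C : Set V := {x | σ.SameCycle c x} with hC
  have hpowI : ∀ k : ℕ, (σ ^ k) c ∉ I := by
    intro k
    induction k with
    | zero => simpa using hc
    | succ k ih => rw [pow_succ', Equiv.Perm.mul_apply, hσI]; exact ih
  have hCpow : ∀ x ∈ C, ∃ k : ℕ, (σ ^ k) c = x := fun x hx =>
    let ⟨k, _, hk⟩ := Equiv.Perm.SameCycle.exists_pow_eq' hx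
    ⟨k, hk⟩
  have hCI : ∀ x ∈ C, x ∉ I := by
    intro x hx
    obtain ⟨k, rfl⟩ := hCpow x hx
    exact hpowI k
  have hcC : c ∈ C := Equiv.Perm.SameCycle.refl σ c
  have hσC : ∀ x, σ x ∈ C ↔ x ∈ C := fun x => Equiv.Perm.sameCycle_apply_right
  -- With weight `g` on its edges, the cycle has only eigenvalues of modulus `g`, beyond every
  -- resonance of the old part.
  set g : ℝ := |R| + 1 with hg
  have hgpos : 0 < g := by positivity
  have hgR : R < g := lt_of_le_of_lt (le_abs_self R) (by linarith)
  set a' : V → V → ℝ := fun i j =>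
    a i j + (if j ∈ C ∧ i = σ j then g else 0) + (if i = c then κ j else 0) with ha'
  have ha : ∀ i j, j ∉ I → a i j = 0 := by
    intro i j hij
    by_contra hne
    exact hij (hsupp i j hne).2.2
  have hκ0 : ∀ j ∉ I, κ j = 0 := fun j hj => by
    by_contra hne
    exact hj (hκ j hne).1
  have hsum : ∀ (w : V → ℂ) j, ∑ i, w i * (a' i j : ℂ) =
      ∑ i, w i * (a i j : ℂ) + (if j ∈ C then w (σ j) * g else 0) + w c * κ j := by
    intro w j
    simp only [ha', Complex.ofReal_add, mul_add, Finset.sum_add_distrib]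
    congr 1
    · congr 1
      by_cases hj : j ∈ C
      · simp [hj, apply_ite]
      · simp [hj]
    · simp [apply_ite]
  refine ⟨I ∪ C, a', ?_, ?_, ?_, ?_⟩
  · exact Set.ssubset_iff_of_subset Set.subset_union_left |>.2 ⟨c, Or.inr hcC, hc⟩
  · rintro x y hxy (hx | hx)
    · exact Or.inl (hI x y hxy hx)
    · right
      rw [hM.left_unique hxy (hσM x (hCI x hx)), hσC]
      exact hx
  · intro i j hij
    by_cases h1 : a i j = 0
    · by_cases h2 : j ∈ C ∧ i = σ j
      · obtain ⟨hj, rfl⟩ := h2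
        exact ⟨hM.1 _ (hσM j (hCI j hj)), Or.inr ((hσC j).2 hj), Or.inr hj⟩
      · have h3 : i = c ∧ κ j ≠ 0 := by
          by_contra h3
          apply hij
          simp only [ha', h1, if_neg h2]
          by_cases hic : i = c
          · simpa [hic] using h3
          · simp [hic]
        obtain ⟨rfl, h3⟩ := h3
        exact ⟨(hκ j h3).2, Or.inr hcC, Or.inl (hκ j h3).1⟩
    · obtain ⟨h2, h3, h4⟩ := hsupp i j h1
      exact ⟨h2, Or.inl h3, Or.inl h4⟩
  · intro μ w hw hws
    have hg0 : (g : ℂ) ≠ 0 := by exact_mod_cast hgpos.ne'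
    have hwC : ∀ j ∈ C, w (σ j) = μ / g * w j := by
      intro j hj
      have h1 := hw j (Or.inr hj)
      rw [hsum, if_pos hj, hκ0 j (hCI j hj)] at h1
      simp only [ha _ j (hCI j hj)] at h1
      simp only [Complex.ofReal_zero, mul_zero, Finset.sum_const_zero, zero_add, add_zero] at h1
      field_simp
      rw [mul_comm, ← h1]
      ring
    have hwpow : ∀ k : ℕ, w ((σ ^ k) c) = (μ / g) ^ k * w c := by
      intro k
      induction k with
      | zero => simp
      | succ k ih =>
        have hk : (σ ^ k) c ∈ C := ⟨k, by simp⟩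
        rw [pow_succ', Equiv.Perm.mul_apply, hwC _ hk, ih]
        ring
    have hwI : ∀ j ∈ I, ∑ i, w i * (a i j : ℂ) + w c * κ j = μ * w j := by
      intro j hj
      have h1 := hw j (Or.inl hj)
      rwa [hsum, if_neg fun hjC => hCI j hjC hj, add_zero] at h1
    -- Going round the cycle multiplies `w c` by a power of `μ / g`; if `w c ≠ 0`, then `‖μ‖ = g >
    -- R`, a contradiction.
    have hwc : w c = 0 := by
      by_contra hne
      have h1 := hR μ w hwI (fun s hs => hws s (Or.inl hs)) (hws c (Or.inr hcC)) hne
      have h2 := hwpow (orderOf σ)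
      rw [pow_orderOf_eq_one, Equiv.Perm.one_apply] at h2
      have h3 : (μ / g) ^ orderOf σ = 1 := by
        have : ((μ / g) ^ orderOf σ - 1) * w c = 0 := by rw [sub_mul, ← h2]; ring
        exact sub_eq_zero.1 ((mul_eq_zero.1 this).resolve_right hne)
      have h4 : ‖μ / g‖ = 1 := by
        have h5 := congrArg norm h3
        rw [norm_pow, norm_one] at h5
        exact (pow_eq_one_iff_of_nonneg (norm_nonneg _) (orderOf_pos σ).ne').1 h5
      rw [norm_div, Complex.norm_real, Real.norm_of_nonneg hgpos.le, div_eq_one_iff_eq hgpos.ne']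
        at h4
      linarith
    rintro i (hi | hi)
    · refine h μ w (fun j hj => ?_) (fun s hs => hws s (Or.inl hs)) i hi
      have := hwI j hj
      rwa [hwc, zero_mul, add_zero] at this
    · obtain ⟨k, rfl⟩ := hCpow i hi
      rw [hwpow, hwc, mul_zero]

/-- If all vertices are reachable from `S` and some matching leaves only vertices of `S`
unmatched, some weights on the edges satisfy the Hautus condition. -/
theorem exists_hautusOn_univ (hM : IsMatching D M) (hS : rightUnmatched M ⊆ S)
    (hreach : ∀ v, ∃ s ∈ S, Relation.ReflTransGen D.Adj s v) :
    ∃ a : V → V → ℝ, SupportedOn D a Set.univ ∧ HautusOn a Set.univ S := by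
  classical
  set P : Set V → Prop := fun I => rightUnmatched M ⊆ I ∧ ForwardClosed M I ∧
    ∃ a : V → V → ℝ, SupportedOn D a I ∧ HautusOn a I S with hP
  obtain ⟨I₀, a₀, h1, h2, h3, h4⟩ := exists_hautusOn_stems hM hS
  obtain ⟨I, ⟨hU, hI, a, hsupp, ha⟩, hmax⟩ :=
    (Set.toFinite {I | P I}).exists_maximal ⟨I₀, h1, h2, a₀, h3, h4⟩
  have huniv : I = Set.univ := by
    by_contra hne
    obtain ⟨v, hv⟩ := (Set.ne_univ_iff_exists_notMem I).1 hne
    -- A path from `S` to the missing vertex either enters the complement of `I` from `I` or starts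
    -- outside `I`, in `S`.
    obtain ⟨c, hc, hlink⟩ : ∃ c ∉ I, c ∈ S ∨ ∃ v ∈ I, D.Adj v c := by
      obtain ⟨s, hs, hsv⟩ := hreach v
      induction hsv with
      | refl => exact ⟨s, hv, Or.inl hs⟩
      | @tail b d _ hbd ih =>
        by_cases hb : b ∈ I
        · exact ⟨d, hv, Or.inr ⟨b, hb, hbd⟩⟩
        · exact ih hb
    obtain ⟨I', a', hlt, hI', hsupp', ha''⟩ := ha.exists_extension hM hU hI hsupp hc hlink
    exact hlt.2 (hmax ⟨hU.trans hlt.1, hI', a', hsupp', ha''⟩ hlt.1)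
  subst huniv
  exact ⟨a, hsupp, ha⟩

open Matrix in
/-- The Hautus condition implies the Kalman condition. -/
theorem HautusOn.kalman {n p : ℕ} {A : Matrix (Fin n) (Fin n) ℝ} {B : Matrix (Fin n) (Fin p) ℝ}
    (h : HautusOn A Set.univ {i | ∃ j, B i j ≠ 0}) (hB : IsDedicated B) : Kalman A B := by
  set A' : Matrix (Fin n) (Fin n) ℂ := A.map Complex.ofRealHom with hA'
  set B' : Matrix (Fin n) (Fin p) ℂ := B.map Complex.ofRealHom with hB'
  -- This space is invariant under `A'`, and an eigenvector in it annihilates `B'`. As each column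
  -- has one non-zero entry, the eigenvector vanishes at all input vertices, and the Hautus
  -- condition kills it.
  let N : Submodule ℂ (Fin n → ℂ) := ⨅ k : ℕ, LinearMap.ker (A' ^ k * B').vecMulLinear
  have hN : ∀ w, w ∈ N ↔ ∀ k : ℕ, w ᵥ* (A' ^ k * B') = 0 := by
    intro w
    simp [N, Submodule.mem_iInf]
  have hbot : N = ⊥ := by
    refine eq_bot_of_forall_eigenvector_eq_zero A'.vecMulLinear N (fun w hw => ?_)
      (fun μ w hw hμ => ?_)
    · rw [hN] at hw ⊢
      intro k
      have := hw (k + 1)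
      rw [pow_succ', Matrix.mul_assoc, ← vecMul_vecMul] at this
      exact this
    · ext i
      refine h μ w (fun j _ => congrFun hμ j) ?_ i trivial
      rintro s - ⟨j, hj⟩
      have h1 := congrFun ((hN w).1 hw 0) j
      rw [pow_zero, Matrix.one_mul] at h1
      have h2 : w ᵥ* B' = fun j => ∑ i, w i * (B i j : ℂ) := rfl
      rw [h2] at h1
      change ∑ i, w i * (B i j : ℂ) = 0 at h1
      rw [Finset.sum_eq_single s] at h1
      · have : (B s j : ℂ) ≠ 0 := by exact_mod_cast hj
        exact (mul_eq_zero.1 h1).resolve_right this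
      · intro b _ hb
        have : B b j = 0 := by
          by_contra hne
          exact hb ((hB j).unique hne hj)
        simp [this]
      · simp
  intro w hw
  have h1 : (fun i => (w i : ℂ)) ∈ N := by
    rw [hN]
    intro k
    have h2 : A' ^ k * B' = (A ^ k * B).map Complex.ofRealHom := by
      rw [Matrix.map_mul]
      congr 1
      exact (map_pow Complex.ofRealHom.mapMatrix A k).symm
    have h3 := RingHom.map_vecMul Complex.ofRealHom (A ^ k * B) w
    rw [h2]
    ext j
    refine (h3 j).symm.trans ?_
    rw [hw k]
    simp
  rw [hbot, Submodule.mem_bot] at h1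
  ext i
  have := congrFun h1 i
  simpa using this

end StructSys

namespace StructSys

/-! ### Matchings and strongly connected components -/

theorem IsMatching.card_image_fst {V : Type*} [DecidableEq V] {D : Digraph V}
    {M : Finset (V × V)} (hM : IsMatching D M) : (M.image Prod.fst).card = M.card :=
  Finset.card_image_of_injOn fun e he e' he' h => by
    by_contra hne
    exact (hM.2 e he e' he' hne).1 h

theorem IsMatching.ncard_rightUnmatched_add_card {V : Type*} [Fintype V] {D : Digraph V}
    {M : Finset (V × V)} (hM : IsMatching D M) :
    (rightUnmatched M).ncard + M.card = Fintype.card V := by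
  classical
  have h1 : rightUnmatched M = ((M.image Prod.snd)ᶜ : Finset V) := by
    ext w
    simp [rightUnmatched]
  have h2 : (M.image Prod.snd).card = M.card :=
    Finset.card_image_of_injOn fun e he e' he' h => by
      by_contra hne
      exact (hM.2 e he e' he' hne).2 h
  rw [h1, Set.ncard_coe_finset, ← h2, Finset.card_compl_add_card]

/-- A case of the Mendelsohn–Dulmage theorem: the right vertices covered by a matching are covered
by some maximum matching. -/
theorem IsMatching.exists_isMaximumMatching {V : Type*} [Finite V] {D : Digraph V}
    {M₁ M₂ : Finset (V × V)} (h₁ : IsMatching D M₁) (h₂ : IsMaximumMatching D M₂) :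
    ∃ M, IsMaximumMatching D M ∧ rightUnmatched M ⊆ rightUnmatched M₁ := by
  classical
  have := Fintype.ofFinite V
  -- The fixed point `s` consists of the `M₁`-covered right vertices on alternating paths that begin
  -- at a vertex not covered by `M₂`. `M` switches to `M₁` along these paths and keeps `M₂`
  -- elsewhere, so no left endpoint of `M₂` is lost.
  let F : Set V →o Set V :=
    { toFun := fun s => {w | (∃ v, (v, w) ∈ M₁) ∧
        ∀ v, (v, w) ∈ M₂ → ∃ w' ∈ s, (v, w') ∈ M₁}
      monotone' := fun s s' hss w hw => ⟨hw.1, fun v hv =>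
        let ⟨w', h, h'⟩ := hw.2 v hv
        ⟨w', hss h, h'⟩⟩ }
  set s : Set V := F.lfp with hs
  have hfix : ∀ w, w ∈ s ↔ (∃ v, (v, w) ∈ M₁) ∧
      ∀ v, (v, w) ∈ M₂ → ∃ w' ∈ s, (v, w') ∈ M₁ := by
    intro w
    have : F s = s := F.map_lfp
    exact (Set.ext_iff.1 this w).symm
  set M : Finset (V × V) := Finset.univ.filter fun e =>
    (e ∈ M₁ ∧ e.2 ∈ s) ∨ (e ∈ M₂ ∧ ¬∃ w' ∈ s, (e.1, w') ∈ M₁) with hM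
  have hmem : ∀ v w, (v, w) ∈ M ↔
      ((v, w) ∈ M₁ ∧ w ∈ s) ∨ ((v, w) ∈ M₂ ∧ ¬∃ w' ∈ s, (v, w') ∈ M₁) := by
    intro v w
    simp [hM]
  have hmatch : IsMatching D M := by
    refine ⟨?_, ?_⟩
    · rintro ⟨v, w⟩ he
      rcases (hmem v w).1 he with h | h
      · exact h₁.1 _ h.1
      · exact h₂.1.1 _ h.1
    · rintro ⟨v, w⟩ he ⟨v', w'⟩ he' hne
      rcases (hmem v w).1 he with h | h <;> rcases (hmem v' w').1 he' with h' | h'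
      · exact h₁.2 _ h.1 _ h'.1 hne
      · refine ⟨?_, ?_⟩
        · rintro rfl
          exact h'.2 ⟨w, h.2, h.1⟩
        · rintro rfl
          exact h'.2 (((hfix _).1 h.2).2 _ h'.1)
      · refine ⟨?_, ?_⟩
        · rintro rfl
          exact h.2 ⟨w', h'.2, h'.1⟩
        · rintro rfl
          exact h.2 (((hfix _).1 h'.2).2 _ h.1)
      · exact h₂.1.2 _ h.1 _ h'.1 hne
  refine ⟨M, ⟨hmatch, fun M' hM' => (h₂.2 M' hM').trans ?_⟩, ?_⟩
  · rw [← h₂.1.card_image_fst, ← hmatch.card_image_fst]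
    refine Finset.card_le_card fun v hv => ?_
    obtain ⟨⟨v, w⟩, hvw, rfl⟩ := Finset.mem_image.1 hv
    by_cases h : ∃ w' ∈ s, (v, w') ∈ M₁
    · obtain ⟨w', hw', h'⟩ := h
      exact Finset.mem_image.2 ⟨(v, w'), (hmem _ _).2 (Or.inl ⟨h', hw'⟩), rfl⟩
    · exact Finset.mem_image.2 ⟨(v, w), (hmem _ _).2 (Or.inr ⟨hvw, h⟩), rfl⟩
  · intro w hw v hv
    by_cases hws : w ∈ s
    · exact hw v ((hmem _ _).2 (Or.inl ⟨hv, hws⟩))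
    · have h1 : ¬∀ v, (v, w) ∈ M₂ → ∃ w' ∈ s, (v, w') ∈ M₁ := fun h =>
        hws ((hfix w).2 ⟨⟨v, hv⟩, h⟩)
      push Not at h1
      obtain ⟨u, hu, hu'⟩ := h1
      exact hw u ((hmem _ _).2 (Or.inr ⟨hu, fun ⟨w', h, h'⟩ => hu' w' h h'⟩))

theorem IsSCC.eq_of_mem {V : Type*} {D : Digraph V} {S T : Set V} (hS : IsSCC D S)
    (hT : IsSCC D T) {x : V} (hxS : x ∈ S) (hxT : x ∈ T) : S = T := by
  have hc : (S ∪ T).Nonempty ∧ ∀ v ∈ S ∪ T, ∀ w ∈ S ∪ T, Relation.ReflTransGen D.Adj v w := by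
    have hto : ∀ v ∈ S ∪ T, Relation.ReflTransGen D.Adj v x := by
      rintro v (hv | hv)
      · exact hS.1.2 v hv x hxS
      · exact hT.1.2 v hv x hxT
    have hfrom : ∀ v ∈ S ∪ T, Relation.ReflTransGen D.Adj x v := by
      rintro v (hv | hv)
      · exact hS.1.2 x hxS v hv
      · exact hT.1.2 x hxT v hv
    exact ⟨⟨x, Or.inl hxS⟩, fun v hv w hw => (hto v hv).trans (hfrom w hw)⟩
  have h1 : S ∪ T ⊆ S := hS.2 hc Set.subset_union_left
  have h2 : S ∪ T ⊆ T := hT.2 hc Set.subset_union_right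
  exact Set.Subset.antisymm (Set.subset_union_left.trans h2) (Set.subset_union_right.trans h1)

/-- Every vertex of a finite digraph is reachable from all vertices of some non-top linked
strongly connected component. -/
theorem exists_isNonTopLinkedSCC_reach {V : Type*} [Finite V] (D : Digraph V) (v : V) :
    ∃ C, IsNonTopLinkedSCC D C ∧ ∀ u ∈ C, Relation.ReflTransGen D.Adj u v := by
  set anc : V → Set V := fun u => {x | Relation.ReflTransGen D.Adj x u} with hanc
  -- Among the ancestors of `v`, one with the fewest ancestors is an ancestor of each of its own
  -- ancestors, which therefore form a non-top linked SCC.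
  obtain ⟨u, huv, hmin⟩ := Set.exists_min_image (anc v) (fun u => (anc u).ncard) (Set.toFinite _)
    ⟨v, Relation.ReflTransGen.refl⟩
  have hkey : ∀ y, Relation.ReflTransGen D.Adj y u → Relation.ReflTransGen D.Adj u y := by
    intro y hy
    have hsub : anc y ⊆ anc u := fun z hz => Relation.ReflTransGen.trans hz hy
    have heq := Set.eq_of_subset_of_ncard_le hsub (hmin y (hy.trans huv)) (Set.toFinite _)
    have : u ∈ anc u := Relation.ReflTransGen.refl
    rw [← heq] at this
    exact this
  refine ⟨anc u, ⟨⟨⟨⟨u, .refl⟩, fun x hx y hy => Relation.ReflTransGen.trans hx (hkey y hy)⟩,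
    fun T hT hle x hx => ?_⟩, ?_⟩, fun x hx => Relation.ReflTransGen.trans hx huv⟩
  · exact hT.2 x hx u (hle (Relation.ReflTransGen.refl : Relation.ReflTransGen D.Adj u u))
  · exact fun x hx w hw hxw => hx (Relation.ReflTransGen.head hxw hw)

/-! ### Counting input vertices against components. -/

section Counting

variable {V : Type*} [Finite V] {D : Digraph V} {M : Finset (V × V)} {S : Set V}

theorem numTopAssignable_add_ncard (D : Digraph V) (M : Finset (V × V)) :
    numTopAssignable D M +
      {C : Set V | IsNonTopLinkedSCC D C ∧ ¬(C ∩ rightUnmatched M).Nonempty}.ncard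
      = numNonTopLinkedSCC D := by
  rw [numTopAssignable, numNonTopLinkedSCC, ← Set.ncard_union_eq]
  · congr 1
    ext C
    simp only [Set.mem_union, Set.mem_ofPred_eq]
    tauto
  · exact Set.disjoint_left.2 fun C h h' => h'.2 h.2

/-- Each component without right-unmatched vertices needs a further vertex of `S`, and distinct
components are disjoint. -/
theorem numNonTopLinkedSCC_add_ncard_le (hU : rightUnmatched M ⊆ S)
    (hS : ∀ C, IsNonTopLinkedSCC D C → (C ∩ S).Nonempty) :
    numNonTopLinkedSCC D + (rightUnmatched M).ncard ≤ S.ncard + numTopAssignable D M := by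
  have h1 := numTopAssignable_add_ncard D M
  have h2 := Set.ncard_sdiff_add_ncard_of_subset hU
  set X := {C : Set V | IsNonTopLinkedSCC D C ∧ ¬(C ∩ rightUnmatched M).Nonempty} with hX
  have hex : ∀ C : X, ∃ s, s ∈ C.1 ∧ s ∈ S := fun C => hS C.1 C.2.1
  choose f hfC hfS using hex
  have hinj : Function.Injective f := fun C C' h =>
    Subtype.ext (C.2.1.1.eq_of_mem C'.2.1.1 (hfC C) (h ▸ hfC C'))
  have h3 : X.ncard ≤ (S \ rightUnmatched M).ncard := by
    rw [← Nat.card_coe_set_eq X, ← Set.ncard_univ, ← Set.ncard_image_of_injective _ hinj]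
    refine Set.ncard_le_ncard ?_ (Set.toFinite _)
    rintro _ ⟨C, -, rfl⟩
    exact ⟨hfS C, fun h => C.2.2 ⟨f C, hfC C, h⟩⟩
  omega

/-- The right-unmatched vertices of `M`, with one vertex from each non-top linked strongly connected
component that contains none of them, meet all non-top linked strongly connected components. -/
theorem exists_rightUnmatched_subset_ncard_add_le (D : Digraph V) (M : Finset (V × V)) :
    ∃ S : Set V, rightUnmatched M ⊆ S ∧ (∀ C, IsNonTopLinkedSCC D C → (C ∩ S).Nonempty) ∧
      S.ncard + numTopAssignable D M ≤ (rightUnmatched M).ncard + numNonTopLinkedSCC D := by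
  have h1 := numTopAssignable_add_ncard D M
  set X := {C : Set V | IsNonTopLinkedSCC D C ∧ ¬(C ∩ rightUnmatched M).Nonempty} with hX
  have hne : ∀ C : X, C.1.Nonempty := fun C => C.2.1.1.1.1
  choose f hf using hne
  refine ⟨rightUnmatched M ∪ Set.range f, Set.subset_union_left, fun C hC => ?_, ?_⟩
  · by_cases h : (C ∩ rightUnmatched M).Nonempty
    · exact h.mono (Set.inter_subset_inter_right _ Set.subset_union_left)
    · exact ⟨f ⟨C, hC, h⟩, hf ⟨C, hC, h⟩, Or.inr ⟨_, rfl⟩⟩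
  · have h2 := Set.ncard_union_le (rightUnmatched M) (Set.range f)
    have h3 : (Set.range f).ncard ≤ X.ncard := by
      rw [← Set.image_univ, ← Nat.card_coe_set_eq X, ← Set.ncard_univ]
      exact Set.ncard_image_le (Set.toFinite _)
    omega

end Counting

/-! ### Dedicated inputs: necessary and sufficient conditions. -/

open Matrix

/-- The state vertices that carry an input. -/
def inputVertices {n p : ℕ} (B : Matrix (Fin n) (Fin p) ℝ) : Set (Fin n) :=
  {i | ∃ j, B i j ≠ 0}

theorem IsDedicated.ncard_inputVertices_le {n p : ℕ} {B : Matrix (Fin n) (Fin p) ℝ}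
    (hB : IsDedicated B) : (inputVertices B).ncard ≤ p := by
  choose f hf hf' using hB
  have hsub : inputVertices B ⊆ Set.range f := by
    rintro i ⟨j, hj⟩
    exact ⟨j, (hf' j i hj).symm⟩
  refine (Set.ncard_le_ncard hsub (Set.toFinite _)).trans ?_
  rw [← Set.image_univ]
  refine (Set.ncard_image_le (Set.toFinite _)).trans ?_
  simp [Set.ncard_univ]

theorem exists_isDedicated {n : ℕ} (S : Set (Fin n)) :
    ∃ B : Matrix (Fin n) (Fin S.ncard) ℝ, IsDedicated B ∧ inputVertices B = S := by
  classical
  have e : Fin S.ncard ≃ S := (Finite.equivFinOfCardEq (Nat.card_coe_set_eq S)).symm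
  refine ⟨fun i j => if i = e j then 1 else 0, fun j => ⟨e j, by simp, fun i hi => ?_⟩, ?_⟩
  · by_contra hne
    simp [hne] at hi
  · ext i
    constructor
    · rintro ⟨j, hj⟩
      have : i = e j := by
        by_contra hne
        simp [hne] at hj
      rw [this]
      exact (e j).2
    · intro hi
      exact ⟨e.symm ⟨i, hi⟩, by simp⟩

/-- No edge enters `C`, so the row vectors `e_c A ^ k` with `c ∈ C` remain supported on `C`; without
inputs there they annihilate `B`. -/
theorem Kalman.inter_inputVertices_nonempty {n p : ℕ} {A : Matrix (Fin n) (Fin n) ℝ}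
    {B : Matrix (Fin n) (Fin p) ℝ} (h : Kalman A B) {C : Set (Fin n)}
    (hC : IsNonTopLinkedSCC (stateDigraph A) C) : (C ∩ inputVertices B).Nonempty := by
  by_contra hne
  obtain ⟨c, hc⟩ := hC.1.1.1
  have hsupp : ∀ (k : ℕ), ∀ i ∉ C, ((Pi.single c 1 : Fin n → ℝ) ᵥ* A ^ k) i = 0 := by
    intro k
    induction k with
    | zero =>
      intro i hi
      have : i ≠ c := fun h => hi (h ▸ hc)
      simp [this]
    | succ k ih =>
      intro i hi
      rw [pow_succ, ← vecMul_vecMul]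
      change ∑ j, ((Pi.single c 1 : Fin n → ℝ) ᵥ* A ^ k) j * A j i = 0
      refine Finset.sum_eq_zero fun j _ => ?_
      by_cases hj : j ∈ C
      · have h1 : A j i = 0 := by
          by_contra h1
          exact hC.2 i hi j hj h1
        simp [h1]
      · rw [ih j hj, zero_mul]
  have h0 := h (Pi.single c 1) fun k => by
    ext j
    rw [← vecMul_vecMul]
    change ∑ i, ((Pi.single c 1 : Fin n → ℝ) ᵥ* A ^ k) i * B i j = 0
    refine Finset.sum_eq_zero fun i _ => ?_
    by_cases hi : i ∈ C
    · have h1 : B i j = 0 := by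
        by_contra h1
        exact hne ⟨i, hi, j, h1⟩
      simp [h1]
    · rw [hsupp k i hi, zero_mul]
  have := congrFun h0 c
  simp at this

/-- Hall's theorem assigns to each row of `[A B]` its own column with a non-zero entry: columns of
`A` give matching edges, columns of `B` give inputs. If Hall's condition failed, some rows would be
supported on too few columns and be dependent, giving `w ≠ 0` with `w A = 0` and `w B = 0`. -/
theorem Kalman.exists_isMatching {n p : ℕ} {A : Matrix (Fin n) (Fin n) ℝ}
    {B : Matrix (Fin n) (Fin p) ℝ} (h : Kalman A B) :
    ∃ M, IsMatching (stateDigraph A) M ∧ rightUnmatched M ⊆ inputVertices B := by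
  classical
  set K : Matrix (Fin n) (Fin n ⊕ Fin p) ℝ := fromCols A B with hK
  set t : Fin n → Finset (Fin n ⊕ Fin p) := fun i => Finset.univ.filter fun c => K i c ≠ 0 with ht
  have hall : ∀ R : Finset (Fin n), R.card ≤ (R.biUnion t).card := by
    intro R
    by_contra! hlt
    let K' : Matrix R (R.biUnion t) ℝ := K.submatrix (↑) (↑)
    have hker : LinearMap.ker K'.vecMulLinear ≠ ⊥ :=
      LinearMap.ker_ne_bot_of_finrank_lt (by
        rw [Module.finrank_fintype_fun_eq_card, Module.finrank_fintype_fun_eq_card,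
          Fintype.card_coe, Fintype.card_coe]
        exact hlt)
    obtain ⟨w, hw, hw0⟩ := Submodule.exists_mem_ne_zero_of_ne_bot hker
    let w' : Fin n → ℝ := fun i => if hi : i ∈ R then w ⟨i, hi⟩ else 0
    have hK0 : ∀ c, ∑ i, w' i * K i c = 0 := by
      intro c
      by_cases hc : c ∈ R.biUnion t
      · have h1 : ∑ i : R, w i * K i c = 0 := congrFun hw ⟨c, hc⟩
        rw [← h1, ← Finset.sum_subset (Finset.subset_univ R)]
        · rw [← Finset.sum_coe_sort]
          exact Finset.sum_congr rfl fun i _ => by simp [w']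
        · intro i _ hi
          simp [w', hi]
      · refine Finset.sum_eq_zero fun i _ => ?_
        by_cases hi : i ∈ R
        · have h1 : K i c = 0 := by
            by_contra h1
            exact hc (Finset.mem_biUnion.2 ⟨i, hi, by simpa [ht] using h1⟩)
          rw [h1, mul_zero]
        · simp [w', hi]
    have hA : w' ᵥ* A = 0 := by
      ext j
      exact hK0 (Sum.inl j)
    have hB : w' ᵥ* B = 0 := by
      ext j
      exact hK0 (Sum.inr j)
    have h0 := h w' fun k => by
      cases k with
      | zero => rw [pow_zero, Matrix.one_mul, hB]
      | succ k => rw [pow_succ', Matrix.mul_assoc, ← vecMul_vecMul, hA, zero_vecMul]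
    refine hw0 (funext fun i => ?_)
    have := congrFun h0 i
    simpa [w'] using this
  obtain ⟨f, hf, hft⟩ := (Finset.all_card_le_biUnion_card_iff_exists_injective t).1 hall
  have hfK : ∀ i, K i (f i) ≠ 0 := fun i => by simpa [ht] using hft i
  refine ⟨Finset.univ.filter fun e => f e.2 = Sum.inl e.1, ⟨?_, ?_⟩, ?_⟩
  · rintro ⟨j, i⟩ he
    have he' : f i = Sum.inl j := by simpa using he
    have := hfK i
    rw [he'] at this
    exact this
  · rintro ⟨j, i⟩ he ⟨j', i'⟩ he' hne
    have h1 : f i = Sum.inl j := by simpa using he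
    have h2 : f i' = Sum.inl j' := by simpa using he'
    refine ⟨?_, ?_⟩
    · rintro rfl
      obtain rfl := hf (h1.trans h2.symm)
      exact hne rfl
    · rintro rfl
      obtain rfl := Sum.inl_injective (h1.symm.trans h2)
      exact hne rfl
  · intro i hi
    cases hfi : f i with
    | inl j => exact absurd (by simpa using hfi) (hi j)
    | inr j =>
      have := hfK i
      rw [hfi] at this
      exact ⟨j, this⟩

/-- Dedicated inputs at vertices that include the right-unmatched vertices of a matching and meet
all non-top linked strongly connected components yield structural controllability. -/
theorem structurallyControllable_of_isMatching {n p : ℕ} {A : Matrix (Fin n) (Fin n) ℝ}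
    {B : Matrix (Fin n) (Fin p) ℝ} (hB : IsDedicated B) {M : Finset (Fin n × Fin n)}
    (hM : IsMatching (stateDigraph A) M) (hU : rightUnmatched M ⊆ inputVertices B)
    (hC : ∀ C, IsNonTopLinkedSCC (stateDigraph A) C → (C ∩ inputVertices B).Nonempty) :
    StructurallyControllable A B := by
  obtain ⟨a, hsupp, ha⟩ := exists_hautusOn_univ hM hU fun v => by
    obtain ⟨C, hC', hreach⟩ := exists_isNonTopLinkedSCC_reach (stateDigraph A) v
    obtain ⟨s, hs, hsB⟩ := hC C hC'
    exact ⟨s, hsB, hreach s hs⟩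
  refine StructurallyControllable.of_kalman (A' := a) (fun i j hij => ?_) (ha.kalman hB)
  by_contra hne
  exact (hsupp i j hne).1 hij

theorem StructurallyControllable.exists_kalman {n p : ℕ} {A : Matrix (Fin n) (Fin n) ℝ}
    {B : Matrix (Fin n) (Fin p) ℝ} (h : StructurallyControllable A B) :
    ∃ (A' : Matrix (Fin n) (Fin n) ℝ) (B' : Matrix (Fin n) (Fin p) ℝ),
      stateDigraph A' = stateDigraph A ∧ inputVertices B' = inputVertices B ∧ Kalman A' B' := by
  obtain ⟨A', B', hA, hB, hc, -⟩ := (h 1 one_pos).2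
  refine ⟨A', B', ?_, ?_, hc.kalman⟩
  · ext i j
    exact not_congr (hA j i).symm
  · ext i
    exact exists_congr fun j => not_congr (hB i j).symm

end StructSys

/-! ### The minimum number of dedicated inputs. -/

theorem theorem3 {n : ℕ} (A : Matrix (Fin n) (Fin n) ℝ) (M : Finset (Fin n × Fin n))
    (hM : StructSys.IsMaximumMatching (StructSys.stateDigraph A) M) :
    ∃ p : ℕ,
      IsLeast {q : ℕ | ∃ B : Matrix (Fin n) (Fin q) ℝ,
        StructSys.IsDedicated B ∧ StructSys.StructurallyControllable A B} p ∧
      (p : ℤ) = ((StructSys.rightUnmatched M).ncard : ℤ)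
        + (StructSys.numNonTopLinkedSCC (StructSys.stateDigraph A) : ℤ)
        - (StructSys.maxAssignabilityIndex (StructSys.stateDigraph A) : ℤ) := by
  open StructSys in
  set D := stateDigraph A with hD
  obtain ⟨⟨M₀, hM₀, hα⟩, hub⟩ := isGreatest_maxAssignabilityIndex D
  have hcard : ∀ M', IsMaximumMatching D M' →
      (rightUnmatched M').ncard = (rightUnmatched M).ncard := by
    intro M' hM'
    have h1 := hM'.1.ncard_rightUnmatched_add_card
    have h2 := hM.1.ncard_rightUnmatched_add_card
    have h3 := hM'.2 M hM.1
    have h4 := hM.2 M' hM'.1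
    omega
  have hlower : ∀ (q : ℕ) (B : Matrix (Fin n) (Fin q) ℝ), IsDedicated B →
      StructurallyControllable A B → numNonTopLinkedSCC D + (rightUnmatched M).ncard
        ≤ q + maxAssignabilityIndex D := by
    intro q B hB hAB
    obtain ⟨A', B', hA', hB', hk⟩ := hAB.exists_kalman
    obtain ⟨M₁, hM₁, hU₁⟩ := hk.exists_isMatching
    rw [hA', ← hD] at hM₁
    obtain ⟨M₂, hM₂, hU₂⟩ := hM₁.exists_isMaximumMatching hM
    have h1 := numNonTopLinkedSCC_add_ncard_le (D := D) (hU₂.trans hU₁) fun C hC =>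
      hk.inter_inputVertices_nonempty (by rwa [hA'])
    have h2 := hub ⟨M₂, hM₂, rfl⟩
    have h3 := hB.ncard_inputVertices_le
    rw [hB', hcard M₂ hM₂] at h1
    omega
  -- Applied to a matching `M₀` attaining the maximum assignability index, the construction meets
  -- the lower bound with equality.
  obtain ⟨S, hU, hC, hle⟩ := exists_rightUnmatched_subset_ncard_add_le D M₀
  obtain ⟨B, hB, hBS⟩ := exists_isDedicated S
  have hAB := structurallyControllable_of_isMatching hB hM₀.1 (by rwa [hBS]) (by rwa [hBS])
  have h1 := hlower _ B hB hAB
  rw [hα, hcard M₀ hM₀] at hle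
  refine ⟨_, ⟨⟨B, hB, hAB⟩, ?_⟩, by omega⟩
  rintro q ⟨B', hB', hAB'⟩
  have := hlower q B' hB' hAB'
  omega
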